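/- **Setting.** Fix type constructors, each with an arity. *Base types* are $B ::= \tau \mid C\,B\cdots B$ ($\tau$ a type variable, $C$ a constructor); *ground* base types $b$ contain no variables; a ground type is $t = b_1\to\dots\to b_n\to b$. Write $B'\sqsubseteq B$ if $B'=\sigma B$ for a substitution $\sigma$, write $\equiv$ for the induced equivalence (equality up to renaming of variables), and add a bottom type $\bot$ strictly below every base type and a bottom substitution sending everything to $\bot$. A *component library* $\Lambda$ assigns to every component $c$ a polytype $\forall\bar\tau.\,B'_1\to\dots\to B'_m\to B'$ with base types $B'_j,B'$; $m$ is the arity of $c$. The *type transformer* of $c$ is $[\![c]\!](B_1,\dots,B_m)=\sigma B'$, where $B'_1\to\dots\to B'_m\to B'$ is a fresh instance of the polytype, the variables of the $B_j$ are renamed apart from it and from each other, and $\sigma$ is the most general unifier of the pairs $(B_j,B'_j)$ (the bottom substitution if there is no other unifier). An *abstract cover* $\mathcal A$ is a finite set of elements of the subsumption lattice (base types up to $\equiv$, together with $\bot$) that contains $\tau$ and $\bot$ and is closed under meet; $\alpha_{\mathcal A}(B)$ is the most specific element of $\mathcal A$ that subsumes $B$. **Abstract typing.** Application terms are $e ::=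 x\mid c\mid e\,e$ and normal-form terms are $E ::= e\mid\lambda x.E$. Abstract inference $\Gamma\vdash_{\mathcal A} e\Rightarrow B$ is given by the rules: $\Gamma\vdash_{\mathcal A} x\Rightarrow\alpha_{\mathcal A}(b)$ if $\Gamma(x)=b$; and $\Gamma\vdash_{\mathcal A} c\,e_1\cdots e_m\Rightarrow\alpha_{\mathcal A}([\![c]\!](B_1,\dots,B_m))$ if $m$ is the arity of $c$ and $\Gamma\vdash_{\mathcal A} e_j\Rightarrow B_j$ for all $j$. Abstract checking is given by: $\Gamma\vdash_{\mathcal A}\lambda x.E\Leftarrow b\to t$ if $\Gamma,x{:}b\vdash_{\mathcal A}E\Leftarrow t$; and $\Gamma\vdash_{\mathcal A} e\Leftarrow b$ if $\Gamma\vdash_{\mathcal A} e\Rightarrow B$ and $b\sqsubseteq B$. **The net.** For $t=b_1\to\dots\to b_n\to b$, the *abstract transition net* $\mathcal N(\Lambda,t,\mathcal A)$ is the Petri net with places $P=\mathcal A\setminus\{\bot\}$ and the following transitions: for each component $c$ of arity $m$ and all $A,A_1,\dots,A_m\in P$ with $\alpha_{\mathcal A}([\![c]\!](A_1,\dots,A_m))\equiv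 A$, a transition that consumes one token from $A_j$ for each $j$ (with multiplicity) and produces one token in $A$; and for each place that is initially marked, a copy transition (consuming one token there and producing two) and a delete transition (consuming one token there and producing none). The initial marking has one token in $\alpha_{\mathcal A}(b_i)$ for each $i=1,\dots,n$ (with multiplicity). A *valid path* is a finite firing sequence from the initial marking to a marking that has exactly one token in total, lying in a place $A$ with $b\sqsubseteq A$. **Programs of a path.** Label the $i$-th initial token with the variable $x_i$ (the $x_i$ distinct), and fire the path on labelled tokens: a transition for a component $c$ consumes tokens as the net prescribes, with any choice among the tokens in one place, and labels the produced token $c\,e_1\cdots e_m$, where $e_1,\dots,e_m$ are the labels of the consumed tokens listed in any order; copy transitions duplicate a labelled token and delete transitions discard one. The path *corresponds* to the program $\lambda x_1\dots x_n.\,e$ if such a run can end with a single token, labelled $e$. Let $\mathrm{progs}(\pi)$ be the set of programs corresponding to $\pi$. **Theorem (ATN Soundness).** For every component library $\Lambda$, ground type $t$, abstract cover $\mathcal A$ and valid path $\pi$ of $\mathcal N(\Lambda,t,\mathcal A)$, there is a program $E\in\mathrm{progs}(\pi)$ such that $\cdot\vdash_{\mathcal A}E\Leftarrow t$, where $\cdot$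 is the empty environment. -/

import Mathlib

universe u v w

namespace TypeNets

/-! ### Types -/

/-- The first-order signature given by a family `K` of type constructors: `K n` is the set of
constructors of arity `n` (there are no relation symbols). -/
abbrev tyLang (K : ℕ → Type u) : FirstOrder.Language.{u, 0} := ⟨K, fun _ => Empty⟩

/-- Base types `B ::= τ | C B ⋯ B` with type variables from `V`. -/
abbrev Ty (K : ℕ → Type u) (V : Type w) := (tyLang K).Term V

/-- Ground base types `b ::= C b ⋯ b`. -/
abbrev GTy (K : ℕ → Type u) := Ty K Empty

/-- First-order types over a set `β` of base types: `T ::= B | B → T`. -/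
inductive FunTy (β : Type w) : Type w
  | base : β → FunTy β
  | arr : β → FunTy β → FunTy β

/-- The argument types of `B₁ → ⋯ → Bₙ → B`. -/
def FunTy.args {β : Type w} : FunTy β → List β
  | .base _ => []
  | .arr B T => B :: T.args

/-- The result type of `B₁ → ⋯ → Bₙ → B`. -/
def FunTy.res {β : Type w} : FunTy β → β
  | .base B => B
  | .arr _ T => T.res

/-- The number of arguments of `B₁ → ⋯ → Bₙ → B`. -/
abbrev FunTy.arity {β : Type w} (T : FunTy β) : ℕ := T.args.length

/-- A ground base type seen as a base type. -/
def GTy.toTy {K : ℕ → Type u} (b : GTy K) : Ty K ℕ := b.relabel Empty.elim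

section Subsumption

variable {K : ℕ → Type u} {V W X : Type}

theorem subst_var (B : Ty K V) : B.subst (FirstOrder.Language.Term.var : V → Ty K V) = B := by
  induction B with
  | var => rfl
  | func f ts ih => simp only [FirstOrder.Language.Term.subst, ih]

theorem subst_subst (B : Ty K V) (σ : V → Ty K W) (ρ : W → Ty K X) :
    (B.subst σ).subst ρ = B.subst fun τ => (σ τ).subst ρ := by
  induction B with
  | var => rfl
  | func f ts ih => simp only [FirstOrder.Language.Term.subst, ih]

/-- The subsumption order: `T' ≤ T` iff `T' = σ T` for some substitution `σ`. -/
instance : Preorder (Ty K V) where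
  le T' T := ∃ σ : V → Ty K V, T' = T.subst σ
  le_refl T := ⟨FirstOrder.Language.Term.var, (subst_var T).symm⟩
  le_trans := by
    rintro a b c ⟨σ, rfl⟩ ⟨ρ, rfl⟩
    exact ⟨_, subst_subst c ρ σ⟩

end Subsumption

/-- Base types together with the bottom type `⊥`, which is strictly more specific than every
base type; the order is that of `WithBot`. -/
abbrev BTy (K : ℕ → Type u) (V : Type) := WithBot (Ty K V)

/-- Substitutions from the variables `V` to types over the variables `W`, together with the
bottom substitution `⊥`. -/
abbrev Sub (K : ℕ → Type u) (V W : Type) := WithBot (V → Ty K W)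

section Unification

variable {K : ℕ → Type u} {V W : Type}

/-- Application of a substitution; the bottom substitution sends everything to `⊥`, and every
substitution sends `⊥` to `⊥`. -/
def Sub.apply (σ : Sub K V W) (B : BTy K V) : BTy K W :=
  WithBot.map₂ (fun s T => FirstOrder.Language.Term.subst T s) σ B

/-- The order on substitutions: `σ' ⊑ σ` iff `σ' = ρ ∘ σ` for some `ρ`. -/
def Sub.MoreSpecific (σ' σ : Sub K V W) : Prop :=
  ∃ ρ : Sub K W W, ∀ τ : V,
    σ'.apply ((FirstOrder.Language.Term.var τ : Ty K V) : BTy K V) =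
      ρ.apply (σ.apply ((FirstOrder.Language.Term.var τ : Ty K V) : BTy K V))

/-- `σ` unifies each pair of a family of pairs of types. -/
def IsUnifier {ι : Type} (eqs : ι → BTy K V × BTy K V) (σ : Sub K V W) : Prop :=
  ∀ i, σ.apply (eqs i).1 = σ.apply (eqs i).2

/-- `σ` is a most general unifier of a family of pairs of types. -/
def IsMGU {ι : Type} (eqs : ι → BTy K V × BTy K V) (σ : Sub K V W) : Prop :=
  IsUnifier eqs σ ∧ ∀ σ' : Sub K V W, IsUnifier eqs σ' → σ'.MoreSpecific σ

open Classical in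
/-- A most general unifier. It is unique up to equivalence, and it is the bottom substitution
exactly when there is no other unifier. -/
noncomputable def mgu (W : Type) {ι : Type} (eqs : ι → BTy K V × BTy K V) : Sub K V W :=
  if h : ∃ σ : Sub K V W, IsMGU eqs σ then h.choose else ⊥

end Unification

/-! ### Component libraries and type transformers -/

/-- A component library with set of components `C`: it assigns to each component `c` its polytype
`∀ τ … τ. B₁ → ⋯ → Bₘ → B`, all of whose type variables are quantified. -/
abbrev Library (K : ℕ → Type u) (C : Type v) := C → FunTy (Ty K ℕ)

section Transformers

variable {K : ℕ → Type u} {C : Type v}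

/-- The number of arguments of a component. -/
abbrev Library.arity (Λ : Library K C) (c : C) : ℕ := (Λ c).arity

/-- The type transformer of a component `c`: if a fresh instance of the type of `c` is
`B'₁ → ⋯ → B'ₘ → B'`, then `(B₁, …, Bₘ)` is sent to `σ B'` where `σ` is the most general unifier
of the pairs `(Bᵢ, B'ᵢ)`.
The scope of a type variable is a single type, so the variables of the arguments are renamed
apart from those of the instance and from each other: the variable `x` of the instance becomes
`(none, x)` and the variable `x` of the `i`-th argument becomes `(some i, x)`. -/
noncomputable def Library.transformer (Λ : Library K C) (c : C)
    (B : Fin (Λ.arity c) → BTy K ℕ) : BTy K ℕ :=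
  let inst (T : Ty K ℕ) : Ty K (Option (Fin (Λ.arity c)) × ℕ) := T.relabel fun x => (none, x)
  (mgu ℕ fun i : Fin (Λ.arity c) =>
      (WithBot.map (FirstOrder.Language.Term.relabel fun x => (some i, x)) (B i),
        (inst ((Λ c).args.get i) : BTy K (Option (Fin (Λ.arity c)) × ℕ)))).apply
    (inst (Λ c).res)

end Transformers

/-! ### Abstract covers -/

/-- An abstract cover: a finite set of types, considered up to renaming of type variables, that
contains the top type `τ` and the bottom type `⊥` and is closed under the meet of the subsumption
lattice. -/
structure Cover (K : ℕ → Type u) where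
  /-- The types in the cover. -/
  types : Set (BTy K ℕ)
  finite : types.Finite
  /-- Types are considered up to renaming: distinct elements are not equivalent. -/
  eq_of_equiv : ∀ A ∈ types, ∀ A' ∈ types, A ≤ A' → A' ≤ A → A = A'
  top_mem : ∃ x : ℕ, ((FirstOrder.Language.Term.var x : Ty K ℕ) : BTy K ℕ) ∈ types
  bot_mem : ⊥ ∈ types
  meet_mem : ∀ A ∈ types, ∀ A' ∈ types, ∃ M ∈ types, IsGLB {A, A'} M

section Abstraction

variable {K : ℕ → Type u}

theorem le_var (B : BTy K ℕ) (x : ℕ) : B ≤ ((FirstOrder.Language.Term.var x : Ty K ℕ) : BTy K ℕ) := by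
  induction B using WithBot.recBotCoe with
  | bot => exact bot_le
  | coe B => exact WithBot.coe_le_coe.2 ⟨fun _ => B, rfl⟩

theorem Cover.exists_isLeast (𝓐 : Cover K) (B : BTy K ℕ) :
    ∃ A, IsLeast {A | A ∈ 𝓐.types ∧ B ≤ A} A := by
  obtain ⟨x, hx⟩ := 𝓐.top_mem
  obtain ⟨A, hA⟩ := (𝓐.finite.subset (Set.sep_subset 𝓐.types fun A => B ≤ A)).exists_minimal
    ⟨_, hx, le_var B x⟩
  refine ⟨A, hA.1, fun A' hA' => ?_⟩
  obtain ⟨M, hM, hglb⟩ := 𝓐.meet_mem A hA.1.1 A' hA'.1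
  have h1 : M ≤ A := hglb.1 (by simp)
  have h2 : M ≤ A' := hglb.1 (by simp)
  have h3 : B ≤ M := hglb.2 (by
    rintro Y (rfl | rfl)
    · exact hA.1.2
    · exact hA'.2)
  exact (hA.2 ⟨hM, h3⟩ h1).trans h2

/-- The abstraction function: `α B` is the most specific type in the cover that subsumes `B`. -/
noncomputable def Cover.α (𝓐 : Cover K) (B : BTy K ℕ) : BTy K ℕ := (𝓐.exists_isLeast B).choose

theorem Cover.α_isLeast (𝓐 : Cover K) (B : BTy K ℕ) :
    IsLeast {A | A ∈ 𝓐.types ∧ B ≤ A} (𝓐.α B) := (𝓐.exists_isLeast B).choose_spec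

end Abstraction

/-! ### Terms and abstract type checking -/

/-- Application terms `e ::= x | c | e e`; variables are natural numbers. -/
inductive ATerm (C : Type v) : Type v
  | var : ℕ → ATerm C
  | comp : C → ATerm C
  | app : ATerm C → ATerm C → ATerm C

/-- Normal-form terms `E ::= e | λ x. E`. -/
inductive NTerm (C : Type v) : Type v
  | body : ATerm C → NTerm C
  | lam : ℕ → NTerm C → NTerm C

/-- The application `c e₁ ⋯ eₘ`. -/
def ATerm.mkApp {C : Type v} {m : ℕ} (c : C) (e : Fin m → ATerm C) : ATerm C :=
  (List.ofFn e).foldl ATerm.app (ATerm.comp c)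

/-- The term `λ x₁ … xₙ. e`. -/
def NTerm.lams {C : Type v} (xs : List ℕ) (e : ATerm C) : NTerm C :=
  xs.foldr NTerm.lam (NTerm.body e)

/-- Typing environments: partial maps from variables to ground base types. -/
abbrev Env (K : ℕ → Type u) := ℕ → Option (GTy K)

section Typing

variable {K : ℕ → Type u} {C : Type v}

/-- Abstract type inference `Γ ⊢ e ⟹ B` in the cover `𝓐`. -/
inductive Infer (Λ : Library K C) (𝓐 : Cover K) (Γ : Env K) : ATerm C → BTy K ℕ → Prop
  | var (x : ℕ) (b : GTy K) : Γ x = some b → Infer Λ 𝓐 Γ (ATerm.var x) (𝓐.α b.toTy)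
  | app (c : C) (e : Fin (Λ.arity c) → ATerm C) (B : Fin (Λ.arity c) → BTy K ℕ) :
      (∀ i, Infer Λ 𝓐 Γ (e i) (B i)) →
        Infer Λ 𝓐 Γ (ATerm.mkApp c e) (𝓐.α (Λ.transformer c B))

/-- Abstract type checking `Γ ⊢ E ⟸ t` in the cover `𝓐`. -/
inductive Check (Λ : Library K C) (𝓐 : Cover K) : Env K → NTerm C → FunTy (GTy K) → Prop
  | lam (Γ : Env K) (x : ℕ) (b : GTy K) (E : NTerm C) (t : FunTy (GTy K)) :
      Check Λ 𝓐 (Function.update Γ x (some b)) E t →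
        Check Λ 𝓐 Γ (NTerm.lam x E) (FunTy.arr b t)
  | base (Γ : Env K) (e : ATerm C) (B : BTy K ℕ) (b : GTy K) :
      Infer Λ 𝓐 Γ e B → (b.toTy : BTy K ℕ) ≤ B → Check Λ 𝓐 Γ (NTerm.body e) (FunTy.base b)

end Typing

/-! ### Petri nets -/

/-- A Petri net with places `P` and transitions `T`; `pre p t` is the multiplicity of the edge
from `p` to `t`, and `post t p` is the multiplicity of the edge from `t` to `p`. -/
structure PetriNet (P : Type u) (T : Type v) where
  pre : P → T → ℕ
  post : T → P → ℕ

/-- The firing of the transition `t` from the marking `M₁` to the marking `M₂`. -/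
def PetriNet.Fires {P : Type u} {T : Type v} (N : PetriNet P T) (M₁ : P → ℕ) (t : T)
    (M₂ : P → ℕ) : Prop :=
  ∀ p, N.pre p t ≤ M₁ p ∧ M₂ p = M₁ p - N.pre p t + N.post t p

/-- The sequence of transitions is a path between two markings. -/
def PetriNet.IsPath {P : Type u} {T : Type v} (N : PetriNet P T) :
    (P → ℕ) → List T → (P → ℕ) → Prop
  | M, [], M' => M = M'
  | M, t :: π, M' => ∃ M₁, N.Fires M t M₁ ∧ N.IsPath M₁ π M'

/-- A Petri net with an initial marking (a multiset of initial places) and a set of final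
places. -/
structure TransitionNet (P : Type u) (T : Type v) extends PetriNet P T where
  init : P → ℕ
  final : Set P

/-- A valid final marking has exactly one token, and that token is in a final place. -/
def TransitionNet.IsValidFinal {P : Type u} {T : Type v} (N : TransitionNet P T)
    (M : P → ℕ) : Prop :=
  ∃ f ∈ N.final, M f = 1 ∧ ∀ p, p ≠ f → M p = 0

/-- A valid path leads from the initial marking to some valid final marking. -/
def TransitionNet.IsValidPath {P : Type u} {T : Type v} (N : TransitionNet P T)
    (π : List T) : Prop :=
  ∃ M, N.IsPath N.init π M ∧ N.IsValidFinal M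

/-! ### Abstract transition nets -/

section ATN

variable {K : ℕ → Type u} {C : Type v}

/-- The places of the abstract transition net: the types in the cover other than `⊥`. -/
abbrev Place (𝓐 : Cover K) := {A : BTy K ℕ // A ∈ 𝓐.types ∧ A ≠ ⊥}

/-- The place that is the abstraction of a ground base type. -/
noncomputable def Cover.place (𝓐 : Cover K) (b : GTy K) : Place 𝓐 :=
  ⟨𝓐.α b.toTy, (𝓐.α_isLeast _).1.1, by
    have h := (𝓐.α_isLeast b.toTy).1.2
    rintro h'
    rw [h'] at h
    exact WithBot.not_coe_le_bot _ h⟩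

open Classical in
/-- The initial marking: one token in the abstraction of each query argument. -/
noncomputable def initMarking (𝓐 : Cover K) (t : FunTy (GTy K)) (p : Place 𝓐) : ℕ :=
  (Finset.univ.filter fun i : Fin t.arity => 𝓐.place (t.args.get i) = p).card

/-- The transitions of the abstract transition net: abstract instances of components, and a copy
and a delete transition for each initial place. -/
inductive Transition (Λ : Library K C) (t : FunTy (GTy K)) (𝓐 : Cover K) : Type (max u v)
  | comp (c : C) (As : Fin (Λ.arity c) → Place 𝓐) (A : Place 𝓐)
      (h : 𝓐.α (Λ.transformer c fun j => (As j).1) ≤ A.1 ∧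
        A.1 ≤ 𝓐.α (Λ.transformer c fun j => (As j).1)) : Transition Λ t 𝓐
  | copy (p : Place 𝓐) (h : 0 < initMarking 𝓐 t p) : Transition Λ t 𝓐
  | delete (p : Place 𝓐) (h : 0 < initMarking 𝓐 t p) : Transition Λ t 𝓐

open Classical in
/-- The abstract transition net of the abstract synthesis problem `(Λ, t, 𝓐)`. -/
noncomputable def atn (Λ : Library K C) (t : FunTy (GTy K)) (𝓐 : Cover K) :
    TransitionNet (Place 𝓐) (Transition Λ t 𝓐) where
  pre q
    | .comp _ As _ _ => (Finset.univ.filter fun j => As j = q).card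
    | .copy p _ => if q = p then 1 else 0
    | .delete p _ => if q = p then 1 else 0
  post
    | .comp _ _ A _, q => if q = A then 1 else 0
    | .copy p _, q => if q = p then 2 else 0
    | .delete _ _, _ => 0
  init := initMarking 𝓐 t
  final := {A | (t.res.toTy : BTy K ℕ) ≤ A.1}

/-! ### From paths to programs -/

/-- A collection of tokens, each lying in a place and labelled with the application term that
it stands for. -/
abbrev Tokens (C : Type v) (𝓐 : Cover K) := Multiset (Place 𝓐 × ATerm C)

/-- The initial tokens: the `i`-th query argument `xᵢ` lies in the abstraction of its type. -/
noncomputable def initTokens (C : Type v) (𝓐 : Cover K) (t : FunTy (GTy K)) : Tokens C 𝓐 :=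
  (Finset.univ : Finset (Fin t.arity)).val.map fun i =>
    (𝓐.place (t.args.get i), ATerm.var i.1)

open Classical in
/-- Firing a transition on labelled tokens. A transition for the component `c` consumes `m` tokens,
as many from each place as the net prescribes, and produces a token labelled `c e₁ ⋯ eₘ`, where
`e₁, …, eₘ` are the labels of the consumed tokens in any order: different tokens in one place are
not distinguished, and the incoming edges of a transition are not ordered. Copy transitions
duplicate a token and delete transitions discard one. -/
inductive TokenStep (Λ : Library K C) (t : FunTy (GTy K)) (𝓐 : Cover K) :
    Tokens C 𝓐 → Transition Λ t 𝓐 → Tokens C 𝓐 → Prop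
  | comp (c : C) (As : Fin (Λ.arity c) → Place 𝓐) (A : Place 𝓐) (h)
      (q : Fin (Λ.arity c) → Place 𝓐) (e : Fin (Λ.arity c) → ATerm C) (R : Tokens C 𝓐) :
      (∀ p, (Finset.univ.filter fun j => q j = p).card =
        (atn Λ t 𝓐).pre p (Transition.comp c As A h)) →
      TokenStep Λ t 𝓐 ((Finset.univ.val.map fun j => (q j, e j)) + R)
        (Transition.comp c As A h) ((A, ATerm.mkApp c e) ::ₘ R)
  | copy (p : Place 𝓐) (h) (e : ATerm C) (R : Tokens C 𝓐) :
      TokenStep Λ t 𝓐 ((p, e) ::ₘ R) (Transition.copy p h) ((p, e) ::ₘ (p, e) ::ₘ R)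
  | delete (p : Place 𝓐) (h) (e : ATerm C) (R : Tokens C 𝓐) :
      TokenStep Λ t 𝓐 ((p, e) ::ₘ R) (Transition.delete p h) R

/-- Firing a sequence of transitions on labelled tokens. -/
def TokenPath (Λ : Library K C) (t : FunTy (GTy K)) (𝓐 : Cover K) :
    Tokens C 𝓐 → List (Transition Λ t 𝓐) → Tokens C 𝓐 → Prop
  | S, [], S' => S = S'
  | S, τ :: π, S' => ∃ S₁, TokenStep Λ t 𝓐 S τ S₁ ∧ TokenPath Λ t 𝓐 S₁ π S'

/-- The programs corresponding to a path: the terms `λ x₀ … xₙ₋₁. e` such that firing the path on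
the initial tokens can leave a single token, labelled `e`. -/
def fromPath (Λ : Library K C) (t : FunTy (GTy K)) (𝓐 : Cover K)
    (π : List (Transition Λ t 𝓐)) : Set (NTerm C) :=
  {E | ∃ (p : Place 𝓐) (e : ATerm C), TokenPath Λ t 𝓐 (initTokens C 𝓐 t) π {(p, e)} ∧
    E = NTerm.lams (List.range t.arity) e}

end ATN

end TypeNets

/-! A path of the net can be replayed on labelled tokens so that one invariant persists: each label
infers exactly the type that is the place of its token, in the environment binding every query
argument to its type. Initially this is the variable rule. For a component transition, the freedom
in ordering the consumed labels is used to give the `j`-th argument a label from the `j`-th input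
place; the application rule then types the new label. Other orders need not be well typed, hence the
existential claim. Copying and deleting preserve the invariant trivially. At the end one token is
left, in a place above the result type, so its label checks, and the abstractions discharge the
environment. The replay step is `exists_tokenStep`; the abstractions are handled by `Check.lams`. -/

namespace TypeNets

/-! ### Selecting and counting tokens. -/

section Multisets

open Classical in
/-- A subfamily of the first components of a multiset of pairs can be lifted to a subfamily of
the pairs. -/
theorem exists_map_pair_le {ι α β : Type*} [Nonempty β] (s : Finset ι) (f : ι → α)
    (S : Multiset (α × β)) (h : s.val.map f ≤ S.map Prod.fst) :
    ∃ e : ι → β, (s.val.map fun j => (f j, e j)) ≤ S := by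
  induction s using Finset.induction_on generalizing S with
  -- The values of `e` outside `s` are irrelevant; `Nonempty β` only supplies these.
  | empty => exact ⟨fun _ => Classical.arbitrary β, by simp⟩
  | insert a s ha ih =>
    rw [Finset.insert_val_of_notMem ha, Multiset.map_cons] at h
    obtain ⟨⟨p, b⟩, hmem, rfl : p = f a⟩ :=
      Multiset.mem_map.1 (Multiset.mem_of_le h (Multiset.mem_cons_self _ _))
    obtain ⟨S', rfl⟩ := Multiset.exists_cons_of_mem hmem
    rw [Multiset.map_cons, Multiset.cons_le_cons_iff] at h
    obtain ⟨e, he⟩ := ih S' h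
    refine ⟨Function.update e a b, ?_⟩
    rw [Finset.insert_val_of_notMem ha, Multiset.map_cons, Function.update_self,
      Multiset.cons_le_cons_iff]
    refine le_of_eq_of_le (Multiset.map_congr rfl fun j hj => ?_) he
    rw [Function.update_of_ne (ne_of_mem_of_not_mem hj ha)]

/-- Bridges the two ways of counting: multiplicities for tokens, filtered cardinalities for
`initMarking` and the input edges of the net. -/
theorem count_map_univ {ι α : Type*} [Fintype ι] [DecidableEq α] (f : ι → α) (p : α)
    [DecidablePred fun j => f j = p] :
    (Finset.univ.val.map f).count p = (Finset.univ.filter fun j => f j = p).card := by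
  rw [Multiset.count_map, Finset.card_def, Finset.filter_val]
  congr 1
  exact Multiset.filter_congr fun j _ => eq_comm

end Multisets

/-! ### The environment under the abstractions. -/

section Environments

variable {K : ℕ → Type u} {C : Type v}

/-- The environment obtained from `Γ` by binding the variables `k, k + 1, …` to the argument types
of `t`. -/
def Env.bindArgs : FunTy (GTy K) → ℕ → Env K → Env K
  | .base _, _, Γ => Γ
  | .arr b t, k, Γ => Env.bindArgs t (k + 1) (Function.update Γ k (some b))

theorem Env.bindArgs_of_lt (t : FunTy (GTy K)) (k : ℕ) (Γ : Env K) (x : ℕ) (hx : x < k) :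
    Env.bindArgs t k Γ x = Γ x := by
  induction t generalizing k Γ with
  | base b => rfl
  | arr b t ih =>
    rw [Env.bindArgs, ih _ _ (by omega), Function.update_of_ne hx.ne]

theorem Env.bindArgs_add (t : FunTy (GTy K)) (k : ℕ) (Γ : Env K) (i : Fin t.arity) :
    Env.bindArgs t k Γ (k + i) = some (t.args.get i) := by
  induction t generalizing k Γ with
  | base b => exact i.elim0
  | arr b t ih =>
    rw [Env.bindArgs]
    obtain ⟨_ | i, hi⟩ := i
    -- The remaining bindings start at `k + 1`, so they do not overwrite `k`.
    · exact (Env.bindArgs_of_lt _ _ _ _ k.lt_succ_self).trans (Function.update_self ..)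
    · have h := ih (k + 1) (Function.update Γ k (some b)) ⟨i, Nat.lt_of_succ_lt_succ hi⟩
      rw [Nat.add_right_comm] at h
      exact h

/-- The start `k` is arbitrary because each abstraction passed shifts it by one; `List.range'` and
`Env.bindArgs` unfold in step with the checking rule. -/
theorem Check.lams {Λ : Library K C} {𝓐 : Cover K} {e : ATerm C} {B : BTy K ℕ}
    (t : FunTy (GTy K)) (k : ℕ) (Γ : Env K) (he : Infer Λ 𝓐 (Env.bindArgs t k Γ) e B)
    (hB : (t.res.toTy : BTy K ℕ) ≤ B) :
    Check Λ 𝓐 Γ (NTerm.lams (List.range' k t.arity) e) t := by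
  induction t generalizing k Γ with
  | base b => exact .base Γ e B b he hB
  | arr b t ih => exact .lam Γ k b _ t (ih _ _ he hB)

end Environments

/-! ### Lifting paths to well-typed labelled tokens. -/

section Simulation

variable {K : ℕ → Type u} {C : Type v} {Λ : Library K C} {t : FunTy (GTy K)} {𝓐 : Cover K}

open Classical in
/-- The marking underlying a collection of labelled tokens. -/
noncomputable def Tokens.marking (S : Tokens C 𝓐) (p : Place 𝓐) : ℕ := (S.map Prod.fst).count p

/-- Every label has the type given by the place of its token. -/
def Tokens.WellTyped (Λ : Library K C) (Γ : Env K) (S : Tokens C 𝓐) : Prop :=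
  ∀ x ∈ S, Infer Λ 𝓐 Γ x.2 x.1.1

theorem initTokens_marking : (initTokens C 𝓐 t).marking = initMarking 𝓐 t := by
  classical
  funext p
  rw [Tokens.marking, initTokens, Multiset.map_map, initMarking]
  exact count_map_univ _ p

theorem initTokens_wellTyped (Γ : Env K) :
    (initTokens C 𝓐 t).WellTyped Λ (Env.bindArgs t 0 Γ) := by
  intro x hx
  obtain ⟨i, -, rfl⟩ := Multiset.mem_map.1 hx
  have h := Env.bindArgs_add t 0 Γ i
  rw [Nat.zero_add] at h
  exact .var _ _ h

theorem exists_cons_of_marking_pos {S : Tokens C 𝓐} {p : Place 𝓐} (h : 1 ≤ S.marking p) :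
    ∃ e R, S = (p, e) ::ₘ R := by
  classical
  obtain ⟨⟨q, e⟩, hmem, rfl : q = p⟩ := Multiset.mem_map.1 (Multiset.one_le_count_iff_mem.1 h)
  exact ⟨e, Multiset.exists_cons_of_mem hmem⟩

/-- Each firing of the net lifts to a firing on well-typed labelled tokens. -/
theorem exists_tokenStep {Γ : Env K} {S : Tokens C 𝓐} (hS : S.WellTyped Λ Γ)
    {τ : Transition Λ t 𝓐} {M : Place 𝓐 → ℕ} (h : (atn Λ t 𝓐).Fires S.marking τ M) :
    ∃ S', TokenStep Λ t 𝓐 S τ S' ∧ S'.WellTyped Λ Γ ∧ S'.marking = M := by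
  classical
  cases τ with
  | comp c As A hA =>
    have : Nonempty (ATerm C) := ⟨.comp c⟩
    obtain ⟨e, he⟩ := exists_map_pair_le Finset.univ As S <| Multiset.le_iff_count.2 fun p => by
      exact (count_map_univ As p).trans_le (h p).1
    obtain ⟨R, rfl⟩ := Multiset.le_iff_exists_add.1 he
    -- The places of the arguments are `As` itself, not merely a rearrangement with the same
    -- multiplicities.
    refine ⟨_, .comp c As A hA As e R fun p => by simp only [atn], ?_, ?_⟩
    · intro x hx
      obtain rfl | hx := Multiset.mem_cons.1 hx
      · have hα : 𝓐.α (Λ.transformer c fun j => (As j).1) = A.1 :=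
          𝓐.eq_of_equiv _ (𝓐.α_isLeast _).1.1 _ A.2.1 hA.1 hA.2
        rw [← hα]
        exact .app c e _ fun j => hS (As j, e j) <| Multiset.mem_add.2 <| .inl <|
          Multiset.mem_map_of_mem _ (Finset.mem_univ_val j)
      · exact hS x (Multiset.mem_add.2 (.inr hx))
    · funext p
      have hp := (h p).2
      -- The chosen tokens account exactly for the input edges, so the truncated subtraction in the
      -- firing rule leaves the count of `R`.
      have hc : Tokens.marking (Finset.univ.val.map fun j => (As j, e j)) p =
          (atn Λ t 𝓐).pre p (.comp c As A hA) := by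
        rw [Tokens.marking, Multiset.map_map]
        exact count_map_univ As p
      simp only [atn, Tokens.marking, Multiset.map_add, Multiset.map_map, Function.comp_def,
        Multiset.count_add, Multiset.map_cons, Multiset.count_cons] at hp hc ⊢
      omega
  | copy p hp =>
    obtain ⟨e, R, rfl⟩ := exists_cons_of_marking_pos (S := S) (p := p)
      (by simpa [atn] using (h p).1)
    refine ⟨_, .copy p hp e R, fun x hx => hS x ?_, ?_⟩
    · simpa using hx
    · funext q
      have hq := (h q).2
      simp only [atn, Tokens.marking, Multiset.map_cons, Multiset.count_cons] at hq ⊢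
      split_ifs at hq ⊢ <;> omega
  | delete p hp =>
    obtain ⟨e, R, rfl⟩ := exists_cons_of_marking_pos (S := S) (p := p)
      (by simpa [atn] using (h p).1)
    refine ⟨_, .delete p hp e R, fun x hx => hS x (Multiset.mem_cons_of_mem hx), ?_⟩
    funext q
    have hq := (h q).2
    simp only [atn, Tokens.marking, Multiset.map_cons, Multiset.count_cons] at hq ⊢
    split_ifs at hq ⊢ <;> omega

/-- Each path of the net lifts to a path on well-typed labelled tokens. -/
theorem exists_tokenPath {Γ : Env K} (π : List (Transition Λ t 𝓐)) {S : Tokens C 𝓐}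
    (hS : S.WellTyped Λ Γ) {M : Place 𝓐 → ℕ} (h : (atn Λ t 𝓐).IsPath S.marking π M) :
    ∃ S', TokenPath Λ t 𝓐 S π S' ∧ S'.WellTyped Λ Γ ∧ S'.marking = M := by
  induction π generalizing S with
  | nil => exact ⟨S, rfl, hS, h⟩
  | cons τ π ih =>
    obtain ⟨M₁, h₁, h₂⟩ := h
    obtain ⟨S₁, hstep, hS₁, rfl⟩ := exists_tokenStep hS h₁
    obtain ⟨S', hpath, hS', hM⟩ := ih hS₁ h₂
    exact ⟨S', ⟨S₁, hstep, hpath⟩, hS', hM⟩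

/-- The marking determines the multiset of places, and a multiset whose image is a singleton is a
singleton. -/
theorem eq_singleton_of_marking {S : Tokens C 𝓐} {p : Place 𝓐} (h₁ : S.marking p = 1)
    (h₀ : ∀ q, q ≠ p → S.marking q = 0) : ∃ e, S = {(p, e)} := by
  classical
  have h : S.map Prod.fst = {p} := by
    ext q
    rw [Multiset.count_singleton]
    split_ifs with hq
    · exact hq ▸ h₁
    · exact h₀ q hq
  obtain ⟨⟨q, e⟩, rfl, rfl : q = p⟩ := Multiset.map_eq_singleton.1 h
  exact ⟨e, rfl⟩

end Simulation

end TypeNets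

open TypeNets in
theorem theorem4p3 {K : ℕ → Type u} {C : Type v} (Λ : Library K C) (t : FunTy (GTy K))
    (𝓐 : Cover K) (π : List (Transition Λ t 𝓐)) (hπ : (atn Λ t 𝓐).IsValidPath π) :
    ∃ E ∈ fromPath Λ t 𝓐 π, Check Λ 𝓐 (fun _ => none) E t := by
  obtain ⟨M, hpath, p, hp, h₁, h₀⟩ := hπ
  obtain ⟨S, hS, hty, rfl⟩ := exists_tokenPath π (initTokens_wellTyped fun _ => none)
    (M := M) (by rw [initTokens_marking]; exact hpath)
  obtain ⟨e, rfl⟩ := eq_singleton_of_marking h₁ h₀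
  refine ⟨_, ⟨p, e, hS, rfl⟩, ?_⟩
  rw [List.range_eq_range']
  exact Check.lams t 0 _ (hty (p, e) (Multiset.mem_singleton_self _)) hp
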